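/- Let $X$ be a real Banach space with closed unit ball $B_X$. For a bounded set $C\subseteq X$, $f\in X^*$ and $\alpha>0$, the set $S(C,f,\alpha)=\{x\in C: f(x)>\sup f(C)-\alpha\}$ is a slice of $C$. The space $X$ has the slice D2P (diameter two property) if every slice of $B_X$ has diameter $2$; it has the D2P if every nonempty relatively weakly open subset of $B_X$ has diameter $2$; it has the strong D2P if every convex combination $\sum_{i=1}^n\lambda_iS_i=\{\sum_i\lambda_ix_i: x_i\in S_i\}$ (with $\lambda_i\ge0$, $\sum_i\lambda_i=1$) of slices $S_i$ of $B_X$ has diameter $2$. The dual $X^*$ has the $w^*$-slice D2P, the $w^*$-D2P, or the $w^*$-strong D2P if the same holds for $B_{X^*}$ (with diameters in the norm of $X^*$) and, respectively, $w^*$-slices (slices of $B_{X^*}$ determined by evaluation at elements of $X$), nonempty relatively $w^*$-open subsets, and convex combinations of $w^*$-slices. A closed subspace $Y\subseteq X$ is an M-ideal of $X$ if there is a linear projection $P$ on $X^*$ with $\|f\|=\|Pf\|+\|f-Pf\|$ for all $f\in X^*$ and $\ker P=Y^\perp=\{f\in X^*: f(y)=0 \text{ for all } y\in Y\}$. Let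 $K$ be a compact Hausdorff space, let $Y\neq X$ be a proper M-ideal of $X$, and let $C(K,X)$ and $C(K,Y)$ be the Banach spaces of continuous functions from $K$ to $X$ and to $Y$ with the supremum norm. (i) If $C(K,Y)$ has the strong D2P (respectively the D2P, the slice D2P), then $C(K,X)$ has the strong D2P (respectively the D2P, the slice D2P). (ii) Suppose that $Y\neq\{0\}$. If $C(K,X)^*$ has the $w^*$-strong D2P (respectively the $w^*$-D2P, the $w^*$-slice D2P), then $C(K,Y)^*$ has the $w^*$-strong D2P (respectively the $w^*$-D2P, the $w^*$-slice D2P). -/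

import Mathlib

namespace DiameterTwo

section

variable {E : Type*} [NormedAddCommGroup E] [NormedSpace ℝ E]

/-- The annihilator `Y^⊥ = {f ∈ E* : f y = 0 for all y ∈ Y}` of a subspace `Y` of `E`. -/
def annihilator (Y : Submodule ℝ E) : Submodule ℝ (StrongDual ℝ E) where
  carrier := {f | ∀ y ∈ Y, f y = 0}
  zero_mem' := fun _ _ => rfl
  add_mem' := fun {f g} hf hg y hy => by
    rw [add_apply, hf y hy, hg y hy, add_zero]
  smul_mem' := fun c f hf y hy => by
    rw [smul_apply, hf y hy, smul_zero]

/-- `Y` is an M-ideal of `E`: it is closed, and its annihilator is the kernel of an `L`-projection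
on `E*`, that is, of a linear projection `P` with `‖f‖ = ‖P f‖ + ‖f - P f‖` for all `f`
(such a `P` is automatically bounded). -/
def IsMIdeal (Y : Submodule ℝ E) : Prop :=
  IsClosed (Y : Set E) ∧
    ∃ P : StrongDual ℝ E →L[ℝ] StrongDual ℝ E,
      IsLprojection (StrongDual ℝ E) P ∧ P.ker = annihilator Y

/-- The slice `{x ∈ C : f x > sup f(C) - α}` of `C` determined by `f` and `α`. -/
def slice (C : Set E) (f : StrongDual ℝ E) (α : ℝ) : Set E :=
  {x | x ∈ C ∧ sSup (f '' C) - α < f x}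

/-- The slice of `C ⊆ E*` determined by `x ∈ E` (acting on `E*` by evaluation) and `α`. -/
def weakStarSlice (C : Set (StrongDual ℝ E)) (x : E) (α : ℝ) : Set (StrongDual ℝ E) :=
  slice C (NormedSpace.inclusionInDoubleDual ℝ E x) α

/-- The set `∑ i, c i • S i = {∑ i, c i • x i : x i ∈ S i}`. -/
def combination {n : ℕ} (c : Fin n → ℝ) (S : Fin n → Set E) : Set E :=
  {z | ∃ x : Fin n → E, (∀ i, x i ∈ S i) ∧ z = ∑ i, c i • x i}

end

section

variable (E : Type*) [NormedAddCommGroup E] [NormedSpace ℝ E]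

/-- Every slice of the closed unit ball of `E` has diameter 2. -/
def SliceD2P : Prop :=
  ∀ (f : StrongDual ℝ E) (α : ℝ), 0 < α →
    Metric.diam (slice (Metric.closedBall (0 : E) 1) f α) = 2

/-- Every nonempty relatively weakly open subset of the closed unit ball of `E` has diameter 2. -/
def D2P : Prop :=
  ∀ U : Set (WeakSpace ℝ E), IsOpen U →
    (toWeakSpace ℝ E ⁻¹' U ∩ Metric.closedBall (0 : E) 1).Nonempty →
      Metric.diam (toWeakSpace ℝ E ⁻¹' U ∩ Metric.closedBall (0 : E) 1) = 2

/-- Every convex combination of slices of the closed unit ball of `E` has diameter 2. -/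
def StrongD2P : Prop :=
  ∀ (n : ℕ) (c : Fin n → ℝ) (f : Fin n → StrongDual ℝ E) (α : Fin n → ℝ),
    (∀ i, 0 ≤ c i) → ∑ i, c i = 1 → (∀ i, 0 < α i) →
      Metric.diam
        (combination c fun i => slice (Metric.closedBall (0 : E) 1) (f i) (α i)) = 2

/-- The dual `E*` has the `w*`-slice diameter two property: every `w*`-slice of the closed unit
ball of `E*` has norm diameter 2. -/
def DualWeakStarSliceD2P : Prop :=
  ∀ (x : E) (α : ℝ), 0 < α →
    Metric.diam (weakStarSlice (Metric.closedBall (0 : StrongDual ℝ E) 1) x α) = 2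

/-- The dual `E*` has the `w*`-diameter two property: every nonempty relatively `w*`-open subset
of the closed unit ball of `E*` has norm diameter 2. -/
def DualWeakStarD2P : Prop :=
  ∀ U : Set (WeakDual ℝ E), IsOpen U →
    (StrongDual.toWeakDual ⁻¹' U ∩ Metric.closedBall (0 : StrongDual ℝ E) 1).Nonempty →
      Metric.diam (StrongDual.toWeakDual ⁻¹' U ∩ Metric.closedBall (0 : StrongDual ℝ E) 1) = 2

/-- The dual `E*` has the `w*`-strong diameter two property: every convex combination of
`w*`-slices of the closed unit ball of `E*` has norm diameter 2. -/
def DualWeakStarStrongD2P : Prop :=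
  ∀ (n : ℕ) (c : Fin n → ℝ) (x : Fin n → E) (α : Fin n → ℝ),
    (∀ i, 0 ≤ c i) → ∑ i, c i = 1 → (∀ i, 0 < α i) →
      Metric.diam
        (combination c fun i =>
          weakStarSlice (Metric.closedBall (0 : StrongDual ℝ E) 1) (x i) (α i)) = 2

end

end DiameterTwo

/-!
Let `J : W → Z` be an isometric embedding of normed spaces. Everything rests on an intersection
property of balls, `HasBallProperty`: for `z` in the unit ball of `Z`, finitely many `w` in the unit
ball of `W` and `ε > 0`, some `y ∈ W` satisfies `‖J w + z - J y‖ ≤ 1 + ε` for all these `w`. An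
M-ideal has it by Hahn-Banach separation in a finite `ℓ^∞`-sum (`IsMIdeal.hasBallProperty`), and,
the condition on `y` being convex, a partition of unity carries it over to the inclusion of `C(K, Y)`
in `C(K, X)` (`HasBallProperty.compLeft`). No description of `C(K, X)*` is needed.

The vectors `v = z - J y` that occur here are organised by the filter `ballFilter J`, along which
`J w + v` lies almost in the unit ball for every `w` in the unit ball of `W`. Norm-preserving
extensions of functionals on `W` are exactly the functionals that tend to `0` along this filter;
hence they form a linear subspace of `Z*`, on which restriction to `W` is isometric. It is the
complement of the annihilator of `W` in an `L`-decomposition of `Z*`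
(`HasBallProperty.exists_decomposition`).

*From `W` to `Z`.* Take `w, w'` in the unit ball of `W` that are almost `2` apart, as provided by the
property of `W`, and `z` in the unit ball of `Z`, and form `J w + v` and `J w' + v` with
`v = z - J y` as above. The norm-preserving part of a functional does not see `v`, and the
annihilating part sees only `z`. For slices, `w` and `z` are chosen almost maximal for the two parts.
For a weak neighbourhood of `z`, the points `w`, `w'` are taken weakly close to a point that
approximates `z` on the norm-preserving parts, which exists by a form of Goldstine's theorem
(`HasBallProperty.exists_approx`).

*From `Z*` to `W*`.* A functional in the unit ball of `Z*` whose restriction to `W` has norm almost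
`1` lies close to the subspace of norm-preserving functionals, so distances between (convex
combinations of) such functionals are almost preserved by restriction
(`HasBallProperty.norm_combination_sub_le`). A slice given by `w ≠ 0` consists of such functionals if
it is small enough. A `w*`-open set can be cut down to such functionals if it contains a functional
of norm `1`, and it does unless `W` is finite-dimensional, which the hypothesis on `Z*` excludes.
-/

namespace DiameterTwo

open Filter Topology

/-! ### Slices and convex combinations of slices of the unit ball -/

section Ball

variable {E : Type*} [NormedAddCommGroup E]

theorem diam_eq_two_iff {S : Set E} (hS : S ⊆ Metric.closedBall 0 1) :
    Metric.diam S = 2 ↔ ∀ ε > 0, ∃ x ∈ S, ∃ y ∈ S, 2 - ε < ‖x - y‖ := by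
  have hle : Metric.diam S ≤ 2 :=
    Metric.diam_le_of_subset_closedBall zero_le_one hS |>.trans (by norm_num)
  constructor
  · intro h ε hε
    by_contra! hcon
    have : Metric.diam S ≤ max (2 - ε) 0 :=
      Metric.diam_le_of_forall_dist_le (le_max_right _ _) fun x hx y hy =>
        (dist_eq_norm x y).trans_le ((hcon x hx y hy).trans (le_max_left _ _))
    rw [h, le_max_iff] at this
    rcases this with h | h <;> linarith
  · refine fun h => le_antisymm hle (le_of_forall_pos_le_add fun ε hε => ?_)
    obtain ⟨x, hx, y, hy, hxy⟩ := h ε hε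
    have := Metric.dist_le_diam_of_mem (Metric.isBounded_closedBall.subset hS) hx hy
    rw [dist_eq_norm] at this
    linarith

variable [NormedSpace ℝ E]

theorem exists_norm_sub_lt_apply (f : StrongDual ℝ E) {δ : ℝ} (hδ : 0 < δ) :
    ∃ x, ‖x‖ ≤ 1 ∧ ‖f‖ - δ < f x := by
  obtain ⟨x, hx, hfx⟩ := f.exists_lt_apply_of_lt_opNorm (r := ‖f‖ - δ) (by linarith)
  rw [Real.norm_eq_abs] at hfx
  rcases abs_cases (f x) with ⟨h, -⟩ | ⟨h, -⟩
  · exact ⟨x, hx.le, h ▸ hfx⟩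
  · exact ⟨-x, by simpa using hx.le, by rw [map_neg, ← h]; exact hfx⟩

theorem apply_le_norm_mul (f : StrongDual ℝ E) {x : E} {r : ℝ} (hx : ‖x‖ ≤ r) :
    f x ≤ ‖f‖ * r :=
  (le_abs_self _).trans (f.le_of_opNorm_le_of_le le_rfl hx)

theorem apply_le_norm_of_mem_ball (f : StrongDual ℝ E) {x : E} (hx : ‖x‖ ≤ 1) : f x ≤ ‖f‖ := by
  simpa using apply_le_norm_mul f hx

theorem sSup_image_closedBall (f : StrongDual ℝ E) :
    sSup (f '' Metric.closedBall (0 : E) 1) = ‖f‖ := by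
  refine IsLUB.csSup_eq ⟨?_, fun b hb => ?_⟩ ⟨f 0, 0, by simp, rfl⟩
  · rintro _ ⟨x, hx, rfl⟩
    exact apply_le_norm_of_mem_ball f (by simpa using hx)
  · refine le_of_forall_pos_le_add fun δ hδ => ?_
    obtain ⟨x, hx, hfx⟩ := exists_norm_sub_lt_apply f hδ
    linarith [hb ⟨x, by simpa using hx, rfl⟩]

theorem mem_slice_closedBall {f : StrongDual ℝ E} {α : ℝ} {x : E} :
    x ∈ slice (Metric.closedBall (0 : E) 1) f α ↔ ‖x‖ ≤ 1 ∧ ‖f‖ - α < f x := by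
  simp [slice, sSup_image_closedBall]

theorem mem_weakStarSlice_closedBall {x : E} {α : ℝ} {f : StrongDual ℝ E} :
    f ∈ weakStarSlice (Metric.closedBall (0 : StrongDual ℝ E) 1) x α ↔
      ‖f‖ ≤ 1 ∧ ‖x‖ - α < f x := by
  have h : ‖NormedSpace.inclusionInDoubleDual ℝ E x‖ = ‖x‖ :=
    (NormedSpace.inclusionInDoubleDualLi (E := E) ℝ).norm_map x
  rw [weakStarSlice, mem_slice_closedBall, h]
  rfl

theorem norm_combination_le {n : ℕ} {c : Fin n → ℝ} (h0 : ∀ i, 0 ≤ c i) (h1 : ∑ i, c i = 1)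
    {x : Fin n → E} {r : ℝ} (hx : ∀ i, ‖x i‖ ≤ r) : ‖∑ i, c i • x i‖ ≤ r :=
  calc ‖∑ i, c i • x i‖ ≤ ∑ i, c i * r := norm_sum_le_of_le _ fun i _ => by
        rw [norm_smul, Real.norm_of_nonneg (h0 i)]
        exact mul_le_mul_of_nonneg_left (hx i) (h0 i)
    _ = r := by rw [← Finset.sum_mul, h1, one_mul]

theorem combination_subset_closedBall {n : ℕ} {c : Fin n → ℝ} (h0 : ∀ i, 0 ≤ c i)
    (h1 : ∑ i, c i = 1) {S : Fin n → Set E} (hS : ∀ i, S i ⊆ Metric.closedBall 0 1) :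
    combination c S ⊆ Metric.closedBall 0 1 := by
  rintro _ ⟨x, hx, rfl⟩
  simpa using norm_combination_le h0 h1 fun i => by simpa using hS i (hx i)

theorem slice_subset (C : Set E) (f : StrongDual ℝ E) (α : ℝ) : slice C f α ⊆ C := fun _ h => h.1

theorem combination_fin_one (S : Fin 1 → Set E) : combination (fun _ => 1) S = S 0 := by
  ext z
  constructor
  · rintro ⟨x, hx, rfl⟩
    simpa using hx 0
  · exact fun hz => ⟨fun _ => z, fun i => Subsingleton.elim 0 i ▸ hz, by simp⟩

end Ball

/-! ### The ball property and norm-preserving extensions -/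

section BallProperty

variable {W Z : Type*} [NormedAddCommGroup W] [NormedSpace ℝ W] [NormedAddCommGroup Z]
  [NormedSpace ℝ Z]

/-- The filter on `Z` generated by the sets `{v | ‖J w + v‖ ≤ 1 + δ}`, where `‖w‖ ≤ 1` and
`δ > 0`: along it, `J w + v` lies almost in the unit ball, for every `w` in the unit ball. -/
def ballFilter (J : W →ₗᵢ[ℝ] Z) : Filter Z where
  sets := {s | ∃ F : Finset W, (∀ w ∈ F, ‖w‖ ≤ 1) ∧ ∃ δ > 0,
    ∀ v, (∀ w ∈ F, ‖J w + v‖ ≤ 1 + δ) → v ∈ s}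
  univ_sets := ⟨∅, by simp, 1, one_pos, fun _ _ => trivial⟩
  sets_of_superset := by
    rintro s t ⟨F, hF, δ, hδ, h⟩ hst
    exact ⟨F, hF, δ, hδ, fun v hv => hst (h v hv)⟩
  inter_sets := by
    classical
    rintro s t ⟨F, hF, δ, hδ, h⟩ ⟨F', hF', δ', hδ', h'⟩
    refine ⟨F ∪ F', fun w hw => ?_, min δ δ', lt_min hδ hδ', fun v hv => ⟨?_, ?_⟩⟩
    · exact (Finset.mem_union.1 hw).elim (hF w) (hF' w)
    · refine h v fun w hw => (hv w (Finset.mem_union_left _ hw)).trans ?_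
      gcongr
      exact min_le_left _ _
    · refine h' v fun w hw => (hv w (Finset.mem_union_right _ hw)).trans ?_
      gcongr
      exact min_le_right _ _

/-- The ball property of `W`, embedded in `Z` by `J`: for `z` in the unit ball of `Z`, finitely
many `w` in the unit ball of `W` and `ε > 0`, there is `y ∈ W` with `‖J w + z - J y‖ ≤ 1 + ε` for
all these `w`. -/
def HasBallProperty (J : W →ₗᵢ[ℝ] Z) : Prop :=
  ∀ z, ‖z‖ ≤ 1 → ∀ F : Finset W, (∀ w ∈ F, ‖w‖ ≤ 1) → ∀ ε > 0,
    ∃ y, ∀ w ∈ F, ‖J w + (z - J y)‖ ≤ 1 + ε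

variable {J : W →ₗᵢ[ℝ] Z}

theorem eventually_ballFilter_norm_le {w : W} (hw : ‖w‖ ≤ 1) {δ : ℝ} (hδ : 0 < δ) :
    ∀ᶠ v in ballFilter J, ‖J w + v‖ ≤ 1 + δ :=
  ⟨{w}, by simpa using hw, δ, hδ, fun v hv => hv w (by simp)⟩

theorem HasBallProperty.frequently (hJ : HasBallProperty J) {z : Z} (hz : ‖z‖ ≤ 1) :
    ∃ᶠ v in ballFilter J, ∃ y, v = z - J y := by
  rintro ⟨F, hF, δ, hδ, h⟩
  obtain ⟨y, hy⟩ := hJ z hz F hF δ hδ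
  exact h (z - J y) hy ⟨y, rfl⟩

/-- The restriction of a functional on `Z` to the subspace `J W`, as a functional on `W`. -/
noncomputable def restrict (J : W →ₗᵢ[ℝ] Z) (f : StrongDual ℝ Z) : StrongDual ℝ W :=
  f.comp J.toContinuousLinearMap

@[simp] theorem restrict_apply (f : StrongDual ℝ Z) (w : W) : restrict J f w = f (J w) := rfl

theorem norm_restrict_le (f : StrongDual ℝ Z) : ‖restrict J f‖ ≤ ‖f‖ :=
  ContinuousLinearMap.opNorm_le_bound _ (norm_nonneg _) fun w => by
    simpa using f.le_opNorm (J w)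

theorem exists_restrict_eq (J : W →ₗᵢ[ℝ] Z) (f : StrongDual ℝ W) :
    ∃ g : StrongDual ℝ Z, restrict J g = f ∧ ‖g‖ = ‖f‖ := by
  obtain ⟨g, hg, hn⟩ := _root_.exists_extension_norm_eq J.toLinearMap.range
    (f.comp J.equivRange.symm.toContinuousLinearEquiv.toContinuousLinearMap)
  have hgJ : restrict J g = f := by
    ext w
    have := hg (J.equivRange w)
    simpa using this
  refine ⟨g, hgJ, le_antisymm ?_ (hgJ ▸ norm_restrict_le g)⟩
  rw [hn]
  refine ContinuousLinearMap.opNorm_le_bound _ (norm_nonneg _) fun x => ?_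
  simpa using f.le_opNorm (J.equivRange.symm x)

/-- Choose `w` in the unit ball with `g (J w)` almost `‖g‖`. If `J w + v` and `J (-w) + v` lie almost
in the unit ball, then `g (J w) + g v` and `g (J w) - g v` are at most about `‖g‖`, so `g v` is
small. -/
theorem tendsto_ballFilter_of_norm_restrict_eq {g : StrongDual ℝ Z} (hg : ‖restrict J g‖ = ‖g‖) :
    Tendsto g (ballFilter J) (𝓝 0) := by
  rw [Metric.tendsto_nhds]
  intro ε hε
  have hpos : 0 < ‖g‖ + 1 := by positivity
  obtain ⟨δ, hδ, hδε⟩ : ∃ δ > 0, ‖g‖ * δ + δ < ε :=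
    ⟨ε / 2 / (‖g‖ + 1), by positivity, by
      rw [show ‖g‖ * (ε / 2 / (‖g‖ + 1)) + ε / 2 / (‖g‖ + 1) = ε / 2 by field_simp]
      linarith⟩
  obtain ⟨w, hw, hgw⟩ := exists_norm_sub_lt_apply (restrict J g) hδ
  rw [hg, restrict_apply] at hgw
  filter_upwards [eventually_ballFilter_norm_le (J := J) hw hδ,
    eventually_ballFilter_norm_le (J := J) (w := -w) (by simpa using hw) hδ] with v h1 h2
  have h1 := apply_le_norm_mul g h1
  have h2 := apply_le_norm_mul (-g) h2
  simp only [map_add, map_neg, norm_neg, neg_apply] at h1 h2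
  rw [Real.dist_0_eq_abs, abs_lt]
  constructor <;> linarith

/-- The `L`-decomposition of a functional `f` along a subspace with the ball property: a
norm-preserving extension `g` of the restriction of `f` satisfies `‖f‖ = ‖g‖ + ‖f - g‖`. -/
theorem HasBallProperty.exists_decomposition (hJ : HasBallProperty J) (f : StrongDual ℝ Z) :
    ∃ g : StrongDual ℝ Z, restrict J g = restrict J f ∧ ‖g‖ = ‖restrict J f‖ ∧
      Tendsto g (ballFilter J) (𝓝 0) ∧ ‖g‖ + ‖f - g‖ ≤ ‖f‖ := by
  obtain ⟨g, hgf, hg⟩ := exists_restrict_eq J (restrict J f)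
  have hg0 := tendsto_ballFilter_of_norm_restrict_eq (hgf ▸ hg.symm)
  refine ⟨g, hgf, hg, hg0, le_of_forall_pos_le_add fun ε hε => ?_⟩
  obtain ⟨δ, hδ, hδε⟩ : ∃ δ > 0, ‖f‖ * δ + 3 * δ ≤ ε :=
    ⟨ε / (‖f‖ + 3), by positivity, by field_simp; exact le_rfl⟩
  obtain ⟨z, hz, hfz⟩ := exists_norm_sub_lt_apply (f - g) hδ
  obtain ⟨w, hw, hgw⟩ := exists_norm_sub_lt_apply (restrict J g) hδ
  obtain ⟨v, ⟨y, rfl⟩, hv, hgv⟩ := ((hJ.frequently hz).and_eventually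
    ((eventually_ballFilter_norm_le hw hδ).and
      (Metric.tendsto_nhds.1 hg0 δ hδ))).exists
  have h1 := apply_le_norm_mul f hv
  have h2 : g (J y) = f (J y) := DFunLike.congr_fun hgf y
  have h3 : g (J w) = f (J w) := DFunLike.congr_fun hgf w
  rw [Real.dist_0_eq_abs, abs_lt] at hgv
  rw [hgf, ← hg, restrict_apply] at hgw
  simp only [map_add, map_sub, sub_apply] at h1 hgv hfz
  linarith [hgv.1]

/-- A functional that annihilates `J W` and tends to `0` along the ball filter is `0`. -/
theorem HasBallProperty.eq_zero_of_restrict_eq_zero (hJ : HasBallProperty J) {g : StrongDual ℝ Z}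
    (hg : Tendsto g (ballFilter J) (𝓝 0)) (hr : restrict J g = 0) : g = 0 := by
  by_contra hne
  obtain ⟨z, hz, hgz⟩ := exists_norm_sub_lt_apply g (norm_pos_iff.2 hne)
  rw [sub_self] at hgz
  obtain ⟨v, ⟨y, rfl⟩, hv⟩ :=
    ((hJ.frequently hz).and_eventually (hg.eventually_lt_const hgz)).exists
  have : g (J y) = 0 := DFunLike.congr_fun hr y
  simp [this] at hv

/-- A functional that tends to `0` along the ball filter is the unique norm-preserving extension of
its restriction, since its difference to any such extension vanishes. -/
theorem HasBallProperty.norm_restrict_eq (hJ : HasBallProperty J) {g : StrongDual ℝ Z}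
    (hg : Tendsto g (ballFilter J) (𝓝 0)) : ‖restrict J g‖ = ‖g‖ := by
  obtain ⟨k, hkg, hk, hk0, -⟩ := hJ.exists_decomposition g
  have : g - k = 0 := by
    refine hJ.eq_zero_of_restrict_eq_zero ?_ ?_
    · simpa using! hg.sub hk0
    · ext w
      simpa [sub_eq_zero] using (DFunLike.congr_fun hkg w).symm
  rw [← hk, sub_eq_zero.1 this]

end BallProperty

/-! ### M-ideals have the ball property -/

section MIdeal

variable {X : Type*} [NormedAddCommGroup X] [NormedSpace ℝ X]

/-- The norm of `(x i) ↦ ∑ i, f i (x i)` on a finite `ℓ^∞`-sum is at least `∑ i, ‖f i‖`. -/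
theorem sum_norm_comp_single_le {ι : Type*} [Fintype ι] [DecidableEq ι]
    (f : StrongDual ℝ (ι → X)) :
    ∑ i, ‖f.comp (ContinuousLinearMap.single ℝ (fun _ : ι => X) i)‖ ≤ ‖f‖ := by
  set φ := fun i => f.comp (ContinuousLinearMap.single ℝ (fun _ : ι => X) i)
  refine le_of_forall_pos_le_add fun ε hε => ?_
  obtain ⟨δ, hδ, hδε⟩ : ∃ δ > 0, (Fintype.card ι : ℝ) * δ ≤ ε :=
    ⟨ε / (Fintype.card ι + 1), by positivity, by
      rw [mul_div_assoc', div_le_iff₀ (by positivity)]; nlinarith⟩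
  choose x hx hfx using fun i => exists_norm_sub_lt_apply (φ i) hδ
  have h1 : f x = ∑ i, φ i (x i) := by
    conv_lhs => rw [← Finset.univ_sum_single x]
    simp [φ]
  have h2 : f x ≤ ‖f‖ := apply_le_norm_of_mem_ball f ((pi_norm_le_iff_of_nonneg zero_le_one).2 hx)
  have h3 : ∑ i, (‖φ i‖ - δ) ≤ ∑ i, φ i (x i) := Finset.sum_le_sum fun i _ => (hfx i).le
  rw [Finset.sum_sub_distrib, Finset.sum_const, Finset.card_univ, nsmul_eq_mul] at h3
  linarith

/-- An M-ideal has the ball property. If it failed for `x` and the `w ∈ F`, then the point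
`(w + x)` of the `ℓ^∞`-sum `X^F` would have distance `> 1` from the constant vectors with value in
`Y`. A functional `(f w)` separating them has `∑ f w ∈ Y^⊥ = ker P`, whence
`∑ f w (w + x) = ∑ P (f w) w + ∑ (f w - P (f w)) x ≤ ∑ ‖f w‖`, a contradiction. -/
theorem IsMIdeal.hasBallProperty {Y : Submodule ℝ X} (hY : IsMIdeal Y) :
    HasBallProperty Y.subtypeₗᵢ := by
  classical
  obtain ⟨-, P, hP, hker⟩ := hY
  intro x hx F hF ε hε
  by_contra! hcon
  let a : F → X := fun w => (w : X) + x
  let D : Submodule ℝ (F → X) := LinearMap.range (LinearMap.pi fun _ => Y.subtype)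
  have hdisj : Disjoint (Metric.ball a (1 + ε)) (D : Set (F → X)) := by
    rw [Set.disjoint_right]
    rintro _ ⟨y, rfl⟩ hmem
    obtain ⟨w, hwF, hw⟩ := hcon y
    rw [Metric.mem_ball, dist_comm, dist_eq_norm] at hmem
    have : ‖(w : X) + x - y‖ ≤ _ :=
      norm_le_pi_norm (a - (LinearMap.pi fun _ : F => Y.subtype) y) ⟨w, hwF⟩
    change 1 + ε < ‖(w : X) + (x - y)‖ at hw
    rw [← add_sub_assoc] at hw
    linarith
  obtain ⟨f, u, hfu, hD⟩ := geometric_hahn_banach_open (convex_ball a (1 + ε))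
    Metric.isOpen_ball D.convex hdisj
  have hu : u ≤ 0 := by simpa using hD 0 D.zero_mem
  have hfD : ∀ d ∈ D, f d = 0 := by
    intro d hd
    by_contra hne
    have := hD (((u - 1) / f d) • d) (D.smul_mem _ hd)
    rw [map_smul, smul_eq_mul, div_mul_cancel₀ _ hne] at this
    linarith
  let φ : F → StrongDual ℝ X := fun w => f.comp (ContinuousLinearMap.single ℝ (fun _ : F => X) w)
  have hfφ : ∀ p : F → X, f p = ∑ w, φ w (p w) := fun p => by
    conv_lhs => rw [← Finset.univ_sum_single p]
    simp [φ]
  have hPsum : ∑ w, P (φ w) = 0 := by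
    rw [← map_sum]
    have : ∑ w, φ w ∈ annihilator Y := fun y hy => by
      rw [sum_apply]
      exact (hfφ _).symm.trans (hfD (fun _ => y) ⟨⟨y, hy⟩, rfl⟩)
    rw [← hker] at this
    exact this
  have hPP : ∀ g, P (P g) = P g := fun g => DFunLike.congr_fun hP.proj g
  have hL : ∀ g : StrongDual ℝ X, ‖P g‖ + ‖g - P g‖ = ‖g‖ := fun g => (hP.Lnorm g).symm
  have hPY : ∀ g : StrongDual ℝ X, ∀ y ∈ Y, g y = P g y := fun g y hy => by
    have : g - P g ∈ annihilator Y := by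
      rw [← hker]
      change P (g - P g) = 0
      rw [map_sub, hPP, sub_self]
    exact sub_eq_zero.1 (this y hy)
  have hneg : -f a ≤ ‖f‖ := by
    have h1 : f a = ∑ w : F, (P (φ w) (w : X) + (φ w - P (φ w)) x) := by
      have h0 : ∑ w, P (φ w) x = 0 := by rw [← sum_apply, hPsum]; rfl
      rw [hfφ, ← sub_zero (∑ w, φ w (a w)), ← h0, ← Finset.sum_sub_distrib]
      refine Finset.sum_congr rfl fun w _ => ?_
      simp only [a, map_add, sub_apply]
      rw [hPY (φ w) _ (w : Y).2]
      ring
    rw [h1, ← Finset.sum_neg_distrib]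
    refine (Finset.sum_le_sum fun w _ => ?_).trans (sum_norm_comp_single_le f)
    change _ ≤ ‖φ w‖
    have h2 := apply_le_norm_of_mem_ball (-P (φ w)) (x := ((w : Y) : X)) (hF w w.2)
    have h3 := apply_le_norm_of_mem_ball (-(φ w - P (φ w))) hx
    rw [norm_neg, neg_apply] at h2 h3
    linarith [hL (φ w)]
  have hnorm : 0 < ‖f‖ := by
    rw [norm_pos_iff]
    rintro rfl
    have := hfu a (Metric.mem_ball_self (by positivity))
    simp only [zero_apply] at this
    linarith
  -- This `δ` makes `(1 + ε / 2) * (‖f‖ - δ)` equal to `‖f‖`.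
  obtain ⟨p, hp, hfp⟩ :=
    exists_norm_sub_lt_apply f (δ := ε / 2 * ‖f‖ / (1 + ε / 2)) (by positivity)
  have h4 := hfu (a + (1 + ε / 2) • p) (by
    rw [Metric.mem_ball, dist_eq_norm, add_sub_cancel_left, norm_smul,
      Real.norm_of_nonneg (by positivity)]
    nlinarith)
  rw [map_add, map_smul, smul_eq_mul] at h4
  have h5 : (1 + ε / 2) * (‖f‖ - ε / 2 * ‖f‖ / (1 + ε / 2)) = ‖f‖ := by field_simp; ring
  have h6 := mul_lt_mul_of_pos_left hfp (show 0 < 1 + ε / 2 by positivity)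
  linarith

end MIdeal

/-! ### Spaces of continuous functions -/

section ContinuousFunctions

variable {K : Type*} [TopologicalSpace K] [CompactSpace K]
  {W Z : Type*} [NormedAddCommGroup W] [NormedSpace ℝ W] [NormedAddCommGroup Z] [NormedSpace ℝ Z]

/-- The isometric embedding `C(K, W) → C(K, Z)` given by composition with an isometric embedding
`W → Z`. -/
noncomputable def compLeft (K : Type*) [TopologicalSpace K] [CompactSpace K] (J : W →ₗᵢ[ℝ] Z) :
    C(K, W) →ₗᵢ[ℝ] C(K, Z) where
  toLinearMap := (J.toContinuousLinearMap.compLeftContinuous ℝ K).toLinearMap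
  norm_map' f := by
    rw [ContinuousMap.norm_eq_iSup_norm, ContinuousMap.norm_eq_iSup_norm]
    exact iSup_congr fun k => J.norm_map (f k)

/-- The ball property passes to spaces of continuous functions: near each point of `K` a constant
function `y` is suitable, and a partition of unity glues these together. -/
theorem HasBallProperty.compLeft [T2Space K] {J : W →ₗᵢ[ℝ] Z} (hJ : HasBallProperty J) :
    HasBallProperty (compLeft K J) := by
  classical
  intro z hz F hF ε hε
  have hconv : ∀ k, Convex ℝ (⋂ w ∈ F, {y : W | ‖J (w k) + (z k - J y)‖ ≤ 1 + ε}) := by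
    refine fun k => convex_iInter₂ fun w _ => ?_
    have : {y : W | ‖J (w k) + (z k - J y)‖ ≤ 1 + ε} =
        J.toLinearMap ⁻¹' Metric.closedBall (J (w k) + z k) (1 + ε) := by
      ext y
      simp [dist_comm (J y), dist_eq_norm, add_sub_assoc]
    rw [this]
    exact (convex_closedBall _ _).linear_preimage _
  obtain ⟨y, hy⟩ := exists_continuous_forall_mem_convex_of_local_const hconv fun k => by
    obtain ⟨c, hc⟩ := hJ (z k) ((z.norm_coe_le_norm k).trans hz) (F.image fun w => w k)
      (by simpa using fun w hw => (w.norm_coe_le_norm k).trans (hF w hw)) (ε / 2) (by positivity)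
    refine ⟨c, ?_⟩
    simp only [Set.mem_iInter]
    refine (eventually_all_finset F).2 fun w hw => ?_
    have hcont : ContinuousAt (fun k => ‖J (w k) + (z k - J c)‖) k := by fun_prop
    have hlt : ‖J (w k) + (z k - J c)‖ < 1 + ε :=
      (hc _ (Finset.mem_image_of_mem _ hw)).trans_lt (by linarith)
    exact (hcont.eventually_lt_const hlt).mono fun _ h => h.le
  refine ⟨y, fun w hw => (ContinuousMap.norm_le _ (by positivity)).2 fun k => ?_⟩
  exact Set.mem_iInter₂.1 (hy k) w hw

end ContinuousFunctions

/-! ### Basic neighbourhoods in weak topologies -/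

section WeakTopologies

theorem exists_finset_of_isOpen_weakBilin {E F : Type*} [AddCommGroup E] [Module ℝ E]
    [AddCommGroup F] [Module ℝ F] (B : E →ₗ[ℝ] F →ₗ[ℝ] ℝ) {U : Set (WeakBilin B)} (hU : IsOpen U)
    {x₀ : E} (hx₀ : (show WeakBilin B from x₀) ∈ U) :
    ∃ S : Finset F, ∃ ε > 0, ∀ x : E, (∀ y ∈ S, |B x y - B x₀ y| < ε) →
      (show WeakBilin B from x) ∈ U := by
  obtain ⟨V, hV, rfl⟩ := isOpen_induced_iff.1 hU
  obtain ⟨S, u, hu, hsub⟩ := isOpen_pi_iff.1 hV _ hx₀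
  have : ∀ᶠ ε in 𝓝[>] (0 : ℝ), ∀ y ∈ S, Metric.ball (B x₀ y) ε ⊆ u y :=
    (eventually_all_finset S).2 fun y hy => by
      obtain ⟨ε, hε, h⟩ := Metric.isOpen_iff.1 (hu y hy).1 _ (hu y hy).2
      filter_upwards [Ioo_mem_nhdsGT hε] with δ hδ
      exact (Metric.ball_subset_ball hδ.2.le).trans h
  obtain ⟨ε, h, hε⟩ := (this.and self_mem_nhdsWithin).exists
  exact ⟨S, ε, hε, fun x hx => hsub fun y hy => h y hy (by simpa [Real.dist_eq] using hx y hy)⟩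

variable {E : Type*} [NormedAddCommGroup E] [NormedSpace ℝ E]

theorem exists_finset_of_isOpen_weakSpace {U : Set (WeakSpace ℝ E)} (hU : IsOpen U) {x₀ : E}
    (hx₀ : toWeakSpace ℝ E x₀ ∈ U) :
    ∃ S : Finset (StrongDual ℝ E), ∃ ε > 0, ∀ x, (∀ f ∈ S, |f x - f x₀| < ε) →
      toWeakSpace ℝ E x ∈ U :=
  exists_finset_of_isOpen_weakBilin (topDualPairing ℝ E).flip hU hx₀

theorem exists_finset_of_isOpen_weakDual {U : Set (WeakDual ℝ E)} (hU : IsOpen U)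
    {f₀ : StrongDual ℝ E} (hf₀ : StrongDual.toWeakDual f₀ ∈ U) :
    ∃ S : Finset E, ∃ ε > 0, ∀ f : StrongDual ℝ E, (∀ x ∈ S, |f x - f₀ x| < ε) →
      StrongDual.toWeakDual f ∈ U :=
  exists_finset_of_isOpen_weakBilin (topDualPairing ℝ E) hU hf₀

theorem continuous_weakSpace_apply (f : StrongDual ℝ E) :
    Continuous fun x : WeakSpace ℝ E => f ((toWeakSpace ℝ E).symm x) :=
  WeakBilin.eval_continuous (topDualPairing ℝ E).flip f

theorem continuous_weakDual_apply (x : E) : Continuous fun f : WeakDual ℝ E => f x :=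
  WeakBilin.eval_continuous (topDualPairing ℝ E) x

end WeakTopologies

/-! ### From the subspace to the space -/

section Lifting

variable {W Z : Type*} [NormedAddCommGroup W] [NormedSpace ℝ W] [NormedAddCommGroup Z]
  [NormedSpace ℝ Z] {J : W →ₗᵢ[ℝ] Z}

theorem eventually_nhdsGT_zero_lt {φ : ℝ → ℝ} (hφ : Continuous φ) {a : ℝ} (h : φ 0 < a) :
    ∀ᶠ η in 𝓝[>] (0 : ℝ), φ η < a :=
  eventually_nhdsWithin_of_eventually_nhds ((hφ.tendsto 0).eventually_lt_const h)

theorem norm_inv_smul_le {v : Z} {η : ℝ} (hη : 0 < η) (hv : ‖v‖ ≤ 1 + η) :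
    ‖(1 + η)⁻¹ • v‖ ≤ 1 := by
  rw [norm_smul, norm_inv, Real.norm_of_nonneg (by positivity)]
  exact inv_mul_le_one_of_le₀ hv (by positivity)

/-- Scaling a vector of norm at most `1 + η` into the unit ball changes the value of a functional
`f` by at most `η ‖f‖`. -/
theorem abs_apply_sub_apply_inv_smul_le (f : StrongDual ℝ Z) {v : Z} {η : ℝ} (hη : 0 < η)
    (hv : ‖v‖ ≤ 1 + η) : |f v - f ((1 + η)⁻¹ • v)| ≤ η * ‖f‖ := by
  set u := (1 + η)⁻¹ • v
  have hu : ‖u‖ ≤ 1 := norm_inv_smul_le hη hv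
  have huv : v - u = η • u := by
    have : v = (1 + η) • u := (smul_inv_smul₀ (by positivity) v).symm
    rw [add_smul, one_smul] at this
    exact sub_eq_of_eq_add' this
  rw [← map_sub, huv, map_smul, smul_eq_mul, abs_mul, abs_of_pos hη]
  exact mul_le_mul_of_nonneg_left (by simpa using f.le_of_opNorm_le_of_le le_rfl hu) hη.le

/-- Two points of a slice of the unit ball of `W` can be moved by one and the same vector `v` into
a slice, given by a prescribed functional `f`, of a slightly larger ball of `Z`. -/
theorem HasBallProperty.exists_translate_slice (hJ : HasBallProperty J) (f : StrongDual ℝ Z)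
    {η : ℝ} (hη : 0 < η) {w w' : W} (hw : w ∈ slice (Metric.closedBall 0 1) (restrict J f) η)
    (hw' : w' ∈ slice (Metric.closedBall 0 1) (restrict J f) η) :
    ∃ v, ‖J w + v‖ ≤ 1 + η ∧ ‖J w' + v‖ ≤ 1 + η ∧
      ‖f‖ - 3 * η < f (J w + v) ∧ ‖f‖ - 3 * η < f (J w' + v) := by
  rw [mem_slice_closedBall] at hw hw'
  obtain ⟨g, hgf, hg, hg0, hfg⟩ := hJ.exists_decomposition f
  obtain ⟨z, hz, hfz⟩ := exists_norm_sub_lt_apply (f - g) hη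
  obtain ⟨v, ⟨y, rfl⟩, hv, hv', hgv⟩ := ((hJ.frequently hz).and_eventually
    ((eventually_ballFilter_norm_le hw.1 hη).and
      ((eventually_ballFilter_norm_le hw'.1 hη).and (Metric.tendsto_nhds.1 hg0 η hη)))).exists
  have h1 : g (J y) = f (J y) := DFunLike.congr_fun hgf y
  have h2 := norm_le_norm_add_norm_sub g f
  rw [norm_sub_rev] at h2
  have h3 := hw.2
  have h4 := hw'.2
  rw [Real.dist_0_eq_abs, abs_lt] at hgv
  rw [restrict_apply] at h3 h4
  simp only [map_sub, sub_apply] at hgv hfz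
  refine ⟨_, hv, hv', ?_, ?_⟩ <;> simp only [map_add, map_sub] <;> linarith [hgv.1]

theorem HasBallProperty.diam_combination_slice (hJ : HasBallProperty J) {n : ℕ} {c : Fin n → ℝ}
    (h0 : ∀ i, 0 ≤ c i) (h1 : ∑ i, c i = 1) (f : Fin n → StrongDual ℝ Z) {α : Fin n → ℝ}
    (hα : ∀ i, 0 < α i)
    (hW : ∀ β > 0, Metric.diam (combination c fun i =>
      slice (Metric.closedBall (0 : W) 1) (restrict J (f i)) β) = 2) :
    Metric.diam (combination c fun i => slice (Metric.closedBall (0 : Z) 1) (f i) (α i)) = 2 := by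
  rw [diam_eq_two_iff (combination_subset_closedBall h0 h1 fun i => slice_subset _ _ _)]
  intro ε hε
  have hev : ∀ᶠ η in 𝓝[>] (0 : ℝ), 3 * η < ε ∧ ∀ i, 3 * η + η * ‖f i‖ < α i := by
    refine Eventually.and ?_ (eventually_all.2 fun i => ?_)
    · exact eventually_nhdsGT_zero_lt (by fun_prop) (by simpa)
    · exact eventually_nhdsGT_zero_lt (by fun_prop) (by simpa using hα i)
  obtain ⟨η, ⟨hηε, hηα⟩, hη : 0 < η⟩ := (hev.and self_mem_nhdsWithin).exists
  obtain ⟨_, ⟨w, hw, rfl⟩, _, ⟨w', hw', rfl⟩, hd⟩ := (diam_eq_two_iff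
    (combination_subset_closedBall h0 h1 fun i => slice_subset _ _ _)).1 (hW η hη) η hη
  choose v hv hv' hfv hfv' using fun i => hJ.exists_translate_slice (f i) hη (hw i) (hw' i)
  refine ⟨_, ⟨fun i => (1 + η)⁻¹ • (J (w i) + v i), fun i => mem_slice_closedBall.2
    ⟨norm_inv_smul_le hη (hv i), ?_⟩, rfl⟩, _, ⟨fun i => (1 + η)⁻¹ • (J (w' i) + v i),
      fun i => mem_slice_closedBall.2 ⟨norm_inv_smul_le hη (hv' i), ?_⟩, rfl⟩, ?_⟩
  · have := abs_le.1 (abs_apply_sub_apply_inv_smul_le (f i) hη (hv i))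
    linarith [hfv i, hηα i]
  · have := abs_le.1 (abs_apply_sub_apply_inv_smul_le (f i) hη (hv' i))
    linarith [hfv' i, hηα i]
  · have : ∑ i, c i • (1 + η)⁻¹ • (J (w i) + v i) - ∑ i, c i • (1 + η)⁻¹ • (J (w' i) + v i) =
        (1 + η)⁻¹ • J (∑ i, c i • w i - ∑ i, c i • w' i) := by
      simp only [map_sub, map_sum, map_smul, ← Finset.sum_sub_distrib, Finset.smul_sum]
      refine Finset.sum_congr rfl fun i _ => ?_
      module
    rw [this, norm_smul, J.norm_map, norm_inv, Real.norm_of_nonneg (by positivity),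
      inv_mul_eq_div, lt_div_iff₀ (by positivity)]
    nlinarith

/-- Goldstine's theorem for the functionals on `Z` that tend to `0` along the ball filter: they do
not distinguish the closures of the unit balls of `W` and `Z`, by Hahn-Banach separation in a
finite-dimensional space. -/
theorem HasBallProperty.exists_approx (hJ : HasBallProperty J) {ι : Type*} [Fintype ι]
    (g : ι → StrongDual ℝ Z) (hg : ∀ i, Tendsto (g i) (ballFilter J) (𝓝 0)) {z : Z} (hz : ‖z‖ ≤ 1)
    {η : ℝ} (hη : 0 < η) : ∃ w, ‖w‖ ≤ 1 ∧ ∀ i, |g i (J w) - g i z| < η := by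
  classical
  let T : W →ₗ[ℝ] ι → ℝ := LinearMap.pi fun i => (restrict J (g i)).toLinearMap
  have hmem : (fun i => g i z) ∈ closure (T '' Metric.closedBall 0 1) := by
    by_contra hcon
    obtain ⟨φ, u, hu, hφ⟩ := geometric_hahn_banach_closed_point
      ((convex_closedBall (0 : W) 1).linear_image T).closure isClosed_closure hcon
    let c : ι → ℝ := fun i => φ (Pi.single i 1)
    have hφc : ∀ p, φ p = ∑ i, p i * c i := fun p => by
      conv_lhs => rw [pi_eq_sum_univ' p]
      simp [c]
    let G : StrongDual ℝ Z := ∑ i, c i • g i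
    have hG : Tendsto G (ballFilter J) (𝓝 0) := by
      have := tendsto_finsetSum Finset.univ fun i _ => (hg i).const_mul (c i)
      simp only [mul_zero, Finset.sum_const_zero] at this
      exact this.congr fun x => by simp [G, sum_apply]
    have hGz : ∀ x, G x = ∑ i, g i x * c i := fun x => by simp [G, sum_apply, mul_comm]
    obtain ⟨w, hw, hGw⟩ := exists_norm_sub_lt_apply (restrict J G) (sub_pos.2 hφ)
    have h1 := hu (T w) (subset_closure ⟨w, by simpa using hw, rfl⟩)
    have h2 := apply_le_norm_of_mem_ball G hz
    rw [hJ.norm_restrict_eq hG, restrict_apply] at hGw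
    rw [hφc] at h1 hφ hGw
    rw [hGz] at h2 hGw
    change ∑ i, g i (J w) * c i < u at h1
    linarith
  obtain ⟨_, ⟨w, hw, rfl⟩, hd⟩ := Metric.mem_closure_iff.1 hmem η hη
  refine ⟨w, by simpa using hw, fun i => ?_⟩
  rw [abs_sub_comm, ← Real.dist_eq]
  exact (dist_le_pi_dist _ _ i).trans_lt hd

/-- Given a weak neighbourhood of `z`, take `w`, `w'` weakly close to a point `w₀` of the unit ball of
`W` that approximates `z` on the norm-preserving parts `g f` of the functionals `f` involved. Then
`f (J w + v) ≈ g f (J w₀) + (f - g f) z ≈ f z` for suitable `v = z - J y`. -/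
theorem HasBallProperty.d2p (hJ : HasBallProperty J) (hW : D2P W) : D2P Z := by
  rintro U hU ⟨z, hzU, hz⟩
  replace hz : ‖z‖ ≤ 1 := by simpa using hz
  rw [diam_eq_two_iff Set.inter_subset_right]
  intro ε hε
  obtain ⟨S, θ, hθ, hS⟩ := exists_finset_of_isOpen_weakSpace hU hzU
  choose g hgf hgn hg0 hgf' using fun f : StrongDual ℝ Z => hJ.exists_decomposition f
  have hev : ∀ᶠ η in 𝓝[>] (0 : ℝ), 3 * η < ε ∧ ∀ f ∈ S, 3 * η + η * ‖f‖ < θ := by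
    refine Eventually.and ?_ ((eventually_all_finset S).2 fun f _ => ?_)
    · exact eventually_nhdsGT_zero_lt (by fun_prop) (by simpa)
    · exact eventually_nhdsGT_zero_lt (by fun_prop) (by simpa using hθ)
  obtain ⟨η, ⟨hηε, hηθ⟩, hη : 0 < η⟩ := (hev.and self_mem_nhdsWithin).exists
  obtain ⟨w₀, hw₀, hgw₀⟩ := hJ.exists_approx (fun f : S => g f) (fun f => hg0 f) hz hη
  let V : Set (WeakSpace ℝ W) :=
    ⋂ f ∈ S, {w | |restrict J f ((toWeakSpace ℝ W).symm w) - f (J w₀)| < η}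
  have hV : IsOpen V := isOpen_biInter_finset fun f _ =>
    isOpen_lt ((continuous_weakSpace_apply _).sub continuous_const).abs continuous_const
  have hmemV : ∀ w, toWeakSpace ℝ W w ∈ V ↔ ∀ f ∈ S, |f (J w) - f (J w₀)| < η := by
    simp [V]
  obtain ⟨w, ⟨hwV, hw⟩, w', ⟨hwV', hw'⟩, hd⟩ := (diam_eq_two_iff Set.inter_subset_right).1
    (hW V hV ⟨w₀, (hmemV w₀).2 (by simpa using fun _ _ => hη), by simpa using hw₀⟩) η hη
  obtain ⟨v, ⟨y, hy⟩, hv, hv', hgv⟩ := ((hJ.frequently hz).and_eventually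
    ((eventually_ballFilter_norm_le (by simpa using hw) hη).and
      ((eventually_ballFilter_norm_le (by simpa using hw') hη).and
        ((eventually_all_finset S).2 fun f _ => Metric.tendsto_nhds.1 (hg0 f) η hη)))).exists
  have key : ∀ w, toWeakSpace ℝ W w ∈ V → ‖J w + v‖ ≤ 1 + η →
      (1 + η)⁻¹ • (J w + v) ∈ toWeakSpace ℝ Z ⁻¹' U ∩ Metric.closedBall 0 1 := by
    intro w hwV hv
    refine ⟨hS ((1 + η)⁻¹ • (J w + v)) fun f hf => ?_, by simpa using norm_inv_smul_le hη hv⟩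
    have h1 := abs_le.1 (abs_apply_sub_apply_inv_smul_le f hη hv)
    have h2 := abs_lt.1 ((hmemV w).1 hwV f hf)
    have h3 := abs_lt.1 (hgw₀ ⟨f, hf⟩)
    have h4 := hgv f hf
    have h5 : g f (J y) = f (J y) := DFunLike.congr_fun (hgf f) y
    have h6 : g f (J w₀) = f (J w₀) := DFunLike.congr_fun (hgf f) w₀
    have h7 := hηθ f hf
    rw [Real.dist_0_eq_abs, abs_lt] at h4
    simp only [map_add, hy, map_sub] at h1 h3 h4 ⊢
    rw [abs_lt]
    constructor <;> linarith
  refine ⟨_, key w hwV hv, _, key w' hwV' hv', ?_⟩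
  rw [← smul_sub, add_sub_add_right_eq_sub, ← map_sub, norm_smul, J.norm_map, norm_inv,
    Real.norm_of_nonneg (by positivity), inv_mul_eq_div, lt_div_iff₀ (by positivity)]
  nlinarith

end Lifting

/-! ### From the dual of the space to the dual of the subspace -/

section Restriction

variable {W Z : Type*} [NormedAddCommGroup W] [NormedSpace ℝ W] [NormedAddCommGroup Z]
  [NormedSpace ℝ Z] {J : W →ₗᵢ[ℝ] Z}

theorem HasBallProperty.exists_norm_sub_le (hJ : HasBallProperty J) {f : StrongDual ℝ Z} {η : ℝ}
    (hf : ‖f‖ ≤ 1) (hη : 1 - η ≤ ‖restrict J f‖) :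
    ∃ g : StrongDual ℝ Z,
      Tendsto g (ballFilter J) (𝓝 0) ∧ restrict J g = restrict J f ∧ ‖f - g‖ ≤ η := by
  obtain ⟨g, hgf, hg, hg0, hfg⟩ := hJ.exists_decomposition f
  exact ⟨g, hg0, hgf, by linarith⟩

theorem restrict_combination_sub {n : ℕ} (c : Fin n → ℝ) (f f' : Fin n → StrongDual ℝ Z) :
    restrict J (∑ i, c i • f i - ∑ i, c i • f' i) =
      ∑ i, c i • restrict J (f i) - ∑ i, c i • restrict J (f' i) := by
  ext w
  simp [sum_apply]

/-- Almost norm-preserving functionals in the unit ball of `Z*` lie close to a subspace on which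
restriction to `W` is isometric, so restriction almost preserves distances between their convex
combinations. -/
theorem HasBallProperty.norm_combination_sub_le (hJ : HasBallProperty J) {n : ℕ} {c : Fin n → ℝ}
    (h0 : ∀ i, 0 ≤ c i) (h1 : ∑ i, c i = 1) {f f' : Fin n → StrongDual ℝ Z} {η : ℝ}
    (hf : ∀ i, ‖f i‖ ≤ 1) (hf' : ∀ i, ‖f' i‖ ≤ 1) (hη : ∀ i, 1 - η ≤ ‖restrict J (f i)‖)
    (hη' : ∀ i, 1 - η ≤ ‖restrict J (f' i)‖) :
    ‖∑ i, c i • f i - ∑ i, c i • f' i‖ ≤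
      ‖∑ i, c i • restrict J (f i) - ∑ i, c i • restrict J (f' i)‖ + 2 * η := by
  choose g hg0 hg hfg using fun i => hJ.exists_norm_sub_le (hf i) (hη i)
  choose g' hg0' hg' hfg' using fun i => hJ.exists_norm_sub_le (hf' i) (hη' i)
  have hlim : Tendsto (∑ i, c i • g i - ∑ i, c i • g' i : StrongDual ℝ Z) (ballFilter J) (𝓝 0) := by
    have := (tendsto_finsetSum Finset.univ fun i _ => (hg0 i).const_mul (c i)).sub
      (tendsto_finsetSum Finset.univ fun i _ => (hg0' i).const_mul (c i))
    simp only [mul_zero, Finset.sum_const_zero, sub_zero] at this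
    exact this.congr fun x => by simp [sum_apply]
  have hnorm := hJ.norm_restrict_eq hlim
  simp only [restrict_combination_sub, hg, hg'] at hnorm
  rw [hnorm]
  have h2 := norm_combination_le h0 h1 hfg
  have h3 := norm_combination_le h0 h1 hfg'
  have h4 : ∑ i, c i • f i - ∑ i, c i • f' i = (∑ i, c i • g i - ∑ i, c i • g' i) +
      (∑ i, c i • (f i - g i) - ∑ i, c i • (f' i - g' i)) := by
    simp only [smul_sub, Finset.sum_sub_distrib]
    abel
  rw [h4]
  linarith [norm_add_le (∑ i, c i • g i - ∑ i, c i • g' i)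
    (∑ i, c i • (f i - g i) - ∑ i, c i • (f' i - g' i)),
    norm_sub_le (∑ i, c i • (f i - g i)) (∑ i, c i • (f' i - g' i))]

theorem HasBallProperty.norm_sub_le (hJ : HasBallProperty J) {f f' : StrongDual ℝ Z} {η : ℝ}
    (hf : ‖f‖ ≤ 1) (hf' : ‖f'‖ ≤ 1) (hη : 1 - η ≤ ‖restrict J f‖)
    (hη' : 1 - η ≤ ‖restrict J f'‖) : ‖f - f'‖ ≤ ‖restrict J f - restrict J f'‖ + 2 * η := by
  simpa using hJ.norm_combination_sub_le (n := 1) (c := fun _ => 1) (f := fun _ => f)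
    (f' := fun _ => f') (by simp) (by simp) (fun _ => hf) (fun _ => hf') (fun _ => hη) fun _ => hη'

theorem weakStarSlice_subset {E : Type*} [NormedAddCommGroup E] [NormedSpace ℝ E]
    (C : Set (StrongDual ℝ E)) (x : E) (α : ℝ) : weakStarSlice C x α ⊆ C :=
  slice_subset _ _ _

theorem HasBallProperty.diam_combination_weakStarSlice (hJ : HasBallProperty J) [Nontrivial W]
    {n : ℕ} {c : Fin n → ℝ} (h0 : ∀ i, 0 ≤ c i) (h1 : ∑ i, c i = 1) (w : Fin n → W)
    {α : Fin n → ℝ} (hα : ∀ i, 0 < α i)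
    (hZ : ∀ (w : Fin n → W) (β : Fin n → ℝ), (∀ i, 0 < β i) → Metric.diam (combination c fun i =>
      weakStarSlice (Metric.closedBall (0 : StrongDual ℝ Z) 1) (J (w i)) (β i)) = 2) :
    Metric.diam (combination c fun i =>
      weakStarSlice (Metric.closedBall (0 : StrongDual ℝ W) 1) (w i) (α i)) = 2 := by
  classical
  rw [diam_eq_two_iff (combination_subset_closedBall h0 h1 fun i => weakStarSlice_subset _ _ _)]
  intro ε hε
  obtain ⟨w₀, hw₀⟩ := exists_ne (0 : W)
  -- A slice given by `0` is the whole ball; it may be replaced by any smaller slice.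
  let x : Fin n → W := fun i => if w i = 0 then w₀ else w i
  have hx : ∀ i, x i ≠ 0 := fun i => by
    by_cases h : w i = 0 <;> simp [x, h, hw₀]
  obtain ⟨_, ⟨f, hf, rfl⟩, _, ⟨f', hf', rfl⟩, hd⟩ := (diam_eq_two_iff
    (combination_subset_closedBall h0 h1 fun i => weakStarSlice_subset _ _ _)).1
    (hZ x (fun i => min (α i) (ε / 3 * ‖x i‖)) fun i => lt_min (hα i)
      (by have := norm_pos_iff.2 (hx i); positivity)) (ε / 3) (by positivity)
  have key : ∀ (i : Fin n) (f : StrongDual ℝ Z),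
      f ∈ weakStarSlice (Metric.closedBall 0 1) (J (x i)) (min (α i) (ε / 3 * ‖x i‖)) →
      ‖f‖ ≤ 1 ∧ 1 - ε / 3 ≤ ‖restrict J f‖ ∧
        restrict J f ∈ weakStarSlice (Metric.closedBall 0 1) (w i) (α i) := by
    intro i f hf
    rw [mem_weakStarSlice_closedBall, J.norm_map] at hf
    have hmin := min_le_right (α i) (ε / 3 * ‖x i‖)
    have hmin' := min_le_left (α i) (ε / 3 * ‖x i‖)
    refine ⟨hf.1, ?_, mem_weakStarSlice_closedBall.2 ⟨(norm_restrict_le f).trans hf.1, ?_⟩⟩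
    · have h2 := apply_le_norm_mul (restrict J f) (le_refl ‖x i‖)
      rw [restrict_apply] at h2
      refine le_of_mul_le_mul_right ?_ (norm_pos_iff.2 (hx i))
      linarith [hf.2]
    · by_cases h : w i = 0
      · simp [h, hα i]
      · have : x i = w i := if_neg h
        rw [this] at hf hmin'
        rw [restrict_apply]
        linarith [hf.2]
  have hle := hJ.norm_combination_sub_le h0 h1 (fun i => (key i _ (hf i)).1)
    (fun i => (key i _ (hf' i)).1) (fun i => (key i _ (hf i)).2.1) fun i => (key i _ (hf' i)).2.1
  exact ⟨_, ⟨fun i => restrict J (f i), fun i => (key i _ (hf i)).2.2, rfl⟩, _,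
    ⟨fun i => restrict J (f' i), fun i => (key i _ (hf' i)).2.2, rfl⟩, by linarith⟩

/-- A relatively `w*`-open subset of the unit ball of `W*` that contains a functional of norm `1`
can be cut down to functionals of norm almost `1`, whose extensions are almost norm-preserving. -/
theorem HasBallProperty.diam_inter_of_norm_eq_one (hJ : HasBallProperty J)
    (hZ : DualWeakStarD2P Z) {U : Set (WeakDual ℝ W)} (hU : IsOpen U) {g : StrongDual ℝ W}
    (hgU : StrongDual.toWeakDual g ∈ U) (hg : ‖g‖ = 1) :
    Metric.diam (StrongDual.toWeakDual ⁻¹' U ∩ Metric.closedBall (0 : StrongDual ℝ W) 1) = 2 := by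
  rw [diam_eq_two_iff Set.inter_subset_right]
  intro ε hε
  obtain ⟨w, hw, hgw⟩ := exists_norm_sub_lt_apply g (δ := ε / 3) (by positivity)
  let R : WeakDual ℝ Z → WeakDual ℝ W := fun f =>
    StrongDual.toWeakDual (restrict J (WeakDual.toStrongDual f))
  have hR : Continuous R :=
    WeakDual.continuous_of_continuous_eval fun w => continuous_weakDual_apply (J w)
  obtain ⟨k, hk, hkg⟩ := exists_restrict_eq J g
  obtain ⟨f, ⟨⟨hfU, hfw⟩, hf⟩, f', ⟨⟨hfU', hfw'⟩, hf'⟩, hd⟩ :=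
    (diam_eq_two_iff Set.inter_subset_right).1 (hZ (R ⁻¹' U ∩ {f | 1 - ε / 3 < f (J w)})
      ((hU.preimage hR).inter (isOpen_lt continuous_const (continuous_weakDual_apply _)))
      ⟨k, ⟨by simpa [R, hk] using hgU, by
        rw [hg, ← hk] at hgw
        exact hgw⟩, by simp [hkg, hg]⟩) (ε / 3) (by positivity)
  rw [mem_closedBall_zero_iff] at hf hf'
  have h1 : 1 - ε / 3 ≤ ‖restrict J f‖ :=
    hfw.le.trans (apply_le_norm_of_mem_ball (restrict J f) hw)
  have h2 : 1 - ε / 3 ≤ ‖restrict J f'‖ :=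
    hfw'.le.trans (apply_le_norm_of_mem_ball (restrict J f') hw)
  refine ⟨restrict J f, ⟨hfU, ?_⟩, restrict J f', ⟨hfU', ?_⟩, ?_⟩
  · simpa using (norm_restrict_le f).trans hf
  · simpa using (norm_restrict_le f').trans hf'
  · linarith [hJ.norm_sub_le hf hf' h1 h2]

/-- If some nonzero functional `k` vanishes on the points defining a basic `w*`-neighbourhood, then
moving along `k` reaches the unit sphere inside it. Otherwise `W*` is finite-dimensional, and small
norm balls around functionals of norm `1` are `w*`-open, which contradicts
`HasBallProperty.diam_inter_of_norm_eq_one`. -/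
theorem HasBallProperty.dualWeakStarD2P (hJ : HasBallProperty J) [Nontrivial W]
    (hZ : DualWeakStarD2P Z) : DualWeakStarD2P W := by
  rintro U hU ⟨g, hgU, hg⟩
  rw [mem_closedBall_zero_iff] at hg
  obtain ⟨S, θ, hθ, hS⟩ := exists_finset_of_isOpen_weakDual hU hgU
  let T : StrongDual ℝ W →ₗ[ℝ] S → ℝ :=
    { toFun f x := f x
      map_add' _ _ := rfl
      map_smul' _ _ := rfl }
  by_cases hT : LinearMap.ker T = ⊥
  · exfalso
    have : FiniteDimensional ℝ (StrongDual ℝ W) :=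
      FiniteDimensional.of_injective T (LinearMap.ker_eq_bot.1 hT)
    obtain ⟨C, hC, hTC⟩ := T.exists_antilipschitzWith hT
    obtain ⟨h, hh, -⟩ := exists_dual_vector' ℝ (0 : W)
    let V : Set (WeakDual ℝ W) := ⋂ x ∈ S, {f | |f x - h x| < 1 / (4 * C)}
    have hV : IsOpen V := isOpen_biInter_finset fun x _ =>
      isOpen_lt ((continuous_weakDual_apply x).sub continuous_const).abs continuous_const
    have hpos : (0 : ℝ) < 1 / (4 * C) := by positivity
    have hhV : StrongDual.toWeakDual h ∈ V := by
      simp only [V, Set.mem_iInter, Set.mem_ofPred_eq, StrongDual.coe_toWeakDual, sub_self,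
        abs_zero]
      exact fun _ _ => hpos
    have hdist : ∀ f : StrongDual ℝ W, StrongDual.toWeakDual f ∈ V → dist f h ≤ 1 / 4 := by
      intro f hf
      simp only [V, Set.mem_iInter, Set.mem_ofPred_eq, StrongDual.coe_toWeakDual] at hf
      have h1 : dist (T f) (T h) ≤ 1 / (4 * C) :=
        (dist_pi_le_iff hpos.le).2 fun x => (hf x x.2).le
      calc dist f h ≤ C * dist (T f) (T h) := hTC.le_mul_dist f h
        _ ≤ C * (1 / (4 * C)) := by gcongr
        _ = 1 / 4 := by
          have : (C : ℝ) ≠ 0 := by positivity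
          field_simp
    obtain ⟨f, ⟨hf, -⟩, f', ⟨hf', -⟩, hd⟩ := (diam_eq_two_iff Set.inter_subset_right).1
      (hJ.diam_inter_of_norm_eq_one hZ hV hhV hh) 1 one_pos
    rw [← dist_eq_norm] at hd
    linarith [dist_triangle_right f f' h, hdist f hf, hdist f' hf']
  · obtain ⟨k, hkT, hk⟩ := (Submodule.ne_bot_iff _).1 hT
    have hk0 : 0 < ‖k‖ := norm_pos_iff.2 hk
    have h2 : 1 ≤ ‖g + (2 / ‖k‖) • k‖ := by
      have := norm_sub_le_norm_add ((2 / ‖k‖) • k) g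
      rw [norm_smul, Real.norm_of_nonneg (by positivity), div_mul_cancel₀ _ hk0.ne',
        add_comm] at this
      linarith
    obtain ⟨t, -, ht⟩ := intermediate_value_Icc (f := fun t : ℝ => ‖g + t • k‖)
      (show (0 : ℝ) ≤ 2 / ‖k‖ by positivity) (by fun_prop)
      (show (1 : ℝ) ∈ Set.Icc _ _ from ⟨by simpa using hg, h2⟩)
    refine hJ.diam_inter_of_norm_eq_one hZ hU (hS (g + t • k) fun x hx => ?_) ht
    have : k x = 0 := congr_fun hkT ⟨x, hx⟩
    simpa [this] using hθ

end Restriction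

end DiameterTwo

theorem mainTheorem5 {K : Type*} [TopologicalSpace K] [CompactSpace K] [T2Space K]
    {X : Type*} [NormedAddCommGroup X] [NormedSpace ℝ X] [CompleteSpace X]
    (Y : Submodule ℝ X) (hY : DiameterTwo.IsMIdeal Y) (hproper : Y ≠ ⊤) :
    ((DiameterTwo.StrongD2P C(K, Y) → DiameterTwo.StrongD2P C(K, X)) ∧
      (DiameterTwo.D2P C(K, Y) → DiameterTwo.D2P C(K, X)) ∧
      (DiameterTwo.SliceD2P C(K, Y) → DiameterTwo.SliceD2P C(K, X))) ∧
    (Y ≠ ⊥ →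
      (DiameterTwo.DualWeakStarStrongD2P C(K, X) → DiameterTwo.DualWeakStarStrongD2P C(K, Y)) ∧
      (DiameterTwo.DualWeakStarD2P C(K, X) → DiameterTwo.DualWeakStarD2P C(K, Y)) ∧
      (DiameterTwo.DualWeakStarSliceD2P C(K, X) → DiameterTwo.DualWeakStarSliceD2P C(K, Y))) := by
  have hJ : DiameterTwo.HasBallProperty (DiameterTwo.compLeft K Y.subtypeₗᵢ) :=
    hY.hasBallProperty.compLeft
  refine ⟨⟨?_, hJ.d2p, ?_⟩, fun hbot => ?_⟩
  · exact fun h n c f α h0 h1 hα => hJ.diam_combination_slice h0 h1 f hα fun β hβ =>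
      h n c _ _ h0 h1 fun _ => hβ
  · intro h f α hα
    have := hJ.diam_combination_slice (n := 1) (c := fun _ => 1) (by simp) (by simp) (fun _ => f)
      (fun _ => hα) fun β hβ => by rw [DiameterTwo.combination_fin_one]; exact h _ β hβ
    rwa [DiameterTwo.combination_fin_one] at this
  · have : Nontrivial Y := Submodule.nontrivial_iff_ne_bot.2 hbot
    rcases isEmpty_or_nonempty K with hK | hK
    · -- If `K` is empty, then `C(K, X)* = {0}` has none of the three properties.
      have hdiam : ∀ S : Set (StrongDual ℝ C(K, X)), Metric.diam S ≠ 2 := fun S => by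
        rw [Metric.diam_subsingleton S.subsingleton_of_subsingleton]
        norm_num
      refine ⟨fun h => ?_, fun h => ?_, fun h => ?_⟩
      · exact (hdiam _ (h 1 (fun _ => 1) 0 (fun _ => 1) (by simp) (by simp) (by simp))).elim
      · exact (hdiam _ (h Set.univ isOpen_univ ⟨0, trivial, by simp⟩)).elim
      · exact (hdiam _ (h 0 1 one_pos)).elim
    refine ⟨fun h n c w α h0 h1 hα => ?_, hJ.dualWeakStarD2P, fun h w α hα => ?_⟩
    · exact hJ.diam_combination_weakStarSlice h0 h1 w hα fun w β hβ => h n c _ β h0 h1 hβ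
    · have := hJ.diam_combination_weakStarSlice (n := 1) (c := fun _ => 1) (by simp) (by simp)
        (fun _ => w) (fun _ => hα) fun w β hβ => by
          rw [DiameterTwo.combination_fin_one]; exact h _ _ (hβ 0)
      rwa [DiameterTwo.combination_fin_one] at this
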